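/- Let $G=(V,E)$ be a finite simple graph whose vertex set is partitioned as $V=A\sqcup B$, and suppose $N_B=|B|$ is even. Associate a qubit with each vertex and let $$|G\rangle=\prod_{\{a,b\}\in E}\mathrm{CZ}_{ab}\,|+\rangle^{\otimes |V|},\qquad |+\rangle=\tfrac{1}{\sqrt2}(|0\rangle+|1\rangle),$$ be the graph state of $G$, and $G_B=\mathrm{Tr}_A|G\rangle\langle G|$ its reduced state on $B$. For an $n$-qubit vector $|\psi\rangle$ and an $n$-qubit density matrix $\rho$ put $|\tilde\psi\rangle=\sigma_y^{\otimes n}|\psi^*\rangle$ and $\tilde\rho=\sigma_y^{\otimes n}\rho^*\sigma_y^{\otimes n}$, where $*$ is complex conjugation in the computational basis. Let $\tau_n(|\psi\rangle)=|\langle\psi|\tilde\psi\rangle|$ be the $n$-tangle and $F(\rho,\sigma)=\mathrm{Tr}\sqrt{\sqrt\rho\,\sigma\sqrt\rho}$ the fidelity. Let $\mathbf\Gamma_{BA}\in\mathbb F_2^{B\times A}$ be the block of the adjacency matrix of $G$ with rows in $B$ and columns in $A$, and let $\mathbf D\in\mathbb F_2^B$ be the vector with $\mathbf D_b=1$ if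 $b$ has even degree in the subgraph $G-A$ of $G$ induced by $B$, and $\mathbf D_b=0$ otherwise. A (rank-one projective) measurement on $A$ is an orthonormal basis $(|v_i\rangle)_i$ of the Hilbert space of the qubits in $A$; the basis is arbitrary, so global (entangled) measurements and local ones (all $|v_i\rangle$ product vectors) are both included. Outcome $i$ has probability $p_i=\|(\langle v_i|\otimes I_B)|G\rangle\|^2$ and, if $p_i\neq0$, post-measurement state $|\phi_i\rangle=(\langle v_i|\otimes I_B)|G\rangle/\sqrt{p_i}$ on $B$. Then: 1. If $\mathbf\Gamma_{BA}\mathbf x=\mathbf D$ has a solution $\mathbf x\in\mathbb F_2^A$, then $F(G_B,\tilde G_B)=1$; otherwise $F(G_B,\tilde G_B)=0$. 2. If $\mathbf\Gamma_{BA}\mathbf x=\mathbf D$ has no solution $\mathbf x\in\mathbb F_2^A$, then for every measurement on $A$, local or global, and every outcome $i$ with $p_i\ne0$, $\tau_{N_B}(|\phi_i\rangle)=0$. 3. If $\mathbf\Gamma_{BA}\mathbf x=\mathbf D$ has a solution $\mathbf x\in\mathbb F_2^A$, then there is a measurement on $A$ such that $\tau_{N_B}(|\phi_i\rangle)=1$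 for every outcome $i$ with $p_i\neq0$. -/

import Mathlib

open scoped Matrix MatrixOrder ComplexOrder

noncomputable section

namespace GraphTangle

/-! ### Multi-qubit systems -/

/-- The Hilbert space `(ℂ²)^{⊗ι}` of a collection of qubits labelled by `ι`; coordinates are the
amplitudes in the computational basis, whose elements are the bit strings `ι → Fin 2`. -/
abbrev Qubits (ι : Type*) [Fintype ι] : Type _ := EuclideanSpace ℂ (ι → Fin 2)

/-- Square matrices indexed by the computational basis. -/
abbrev QubitOp (ι : Type*) : Type _ := Matrix (ι → Fin 2) (ι → Fin 2) ℂ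

/-- Application of an operator, given by its computational-basis matrix, to a vector. -/
def applyOp {ι : Type*} [Fintype ι] [DecidableEq ι] (M : QubitOp ι) (ψ : Qubits ι) : Qubits ι :=
  WithLp.toLp 2 (M *ᵥ (fun z => ψ z))

/-- The Pauli matrix `σ_y`. -/
def sigmaY : Matrix (Fin 2) (Fin 2) ℂ := !![0, -Complex.I; Complex.I, 0]

/-- The operator `σ_y^{⊗ι}`. -/
def sigmaYAll (ι : Type*) [Fintype ι] : QubitOp ι :=
  Matrix.of fun x y => ∏ i, sigmaY (x i) (y i)

/-- Wootters' tilde `σ_y^{⊗n} |ψ*⟩` of a vector. -/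
def tildeVec {ι : Type*} [Fintype ι] [DecidableEq ι] (ψ : Qubits ι) : Qubits ι :=
  applyOp (sigmaYAll ι) (WithLp.toLp 2 fun z => star (ψ z))

/-- Wootters' tilde `σ_y^{⊗n} ρ* σ_y^{⊗n}` of a density matrix; `ρ*` is the entrywise conjugate. -/
def tildeOp {ι : Type*} [Fintype ι] [DecidableEq ι] (ρ : QubitOp ι) : QubitOp ι :=
  sigmaYAll ι * ρ.map star * sigmaYAll ι

/-- The `n`-tangle `τ_n(ψ) = |⟨ψ|ψ̃⟩|`, where `n` is the number of labels in `ι`. -/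
def tangle {ι : Type*} [Fintype ι] [DecidableEq ι] (ψ : Qubits ι) : ℝ :=
  ‖inner ℂ ψ (tildeVec ψ)‖

/-- The fidelity `F(ρ, σ) = Tr √(√ρ σ √ρ)`, with square roots of positive semidefinite matrices. -/
def fidelity {ι : Type*} [Fintype ι] [DecidableEq ι] (ρ σ : QubitOp ι) : ℂ :=
  (CFC.sqrt (CFC.sqrt ρ * σ * CFC.sqrt ρ)).trace

/-- The density matrix `|ψ⟩⟨ψ|`. -/
def density {ι : Type*} [Fintype ι] (ψ : Qubits ι) : QubitOp ι :=
  Matrix.of fun x y => ψ x * star (ψ y)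

/-! ### Bipartitions and measurements

The label set `V` is split into a set `A` of measured qubits and its complement `B`. -/

section Bipartite

variable {V : Type*} [Fintype V] [DecidableEq V]

/-- The bit string on `V` that agrees with `x` on `A` and with `y` on the complement of `A`. -/
def glue (A : Finset V) (x : {v // v ∈ A} → Fin 2) (y : {v // v ∉ A} → Fin 2) : V → Fin 2 :=
  fun v => if h : v ∈ A then x ⟨v, h⟩ else y ⟨v, h⟩

/-- The reduced operator on `B` (partial trace over `A`). -/
def reducedB (A : Finset V) (ρ : QubitOp V) : QubitOp {v // v ∉ A} :=
  Matrix.of fun y y' => ∑ x : {v // v ∈ A} → Fin 2, ρ (glue A x y) (glue A x y')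

/-- A rank-one projective (von Neumann) measurement of the qubits in `A`: an arbitrary orthonormal
basis of the Hilbert space of `A`. Its vectors may be entangled; a local measurement is one whose
basis vectors are product vectors. The `2^|A|` outcomes are labelled by bit strings. -/
abbrev Measurement (A : Finset V) : Type _ :=
  OrthonormalBasis ({v // v ∈ A} → Fin 2) ℂ (Qubits {v // v ∈ A})

/-- The vector `(⟨v| ⊗ I_B) |Ψ⟩` on `B`. -/
def contractA (A : Finset V) (v : Qubits {v // v ∈ A}) (Ψ : Qubits V) : Qubits {v // v ∉ A} :=
  WithLp.toLp 2 fun y => ∑ x : {v // v ∈ A} → Fin 2, star (v x) * Ψ (glue A x y)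

/-- The probability `p_i` of outcome `i`. -/
def outcomeProb {A : Finset V} (M : Measurement A) (Ψ : Qubits V) (i : {v // v ∈ A} → Fin 2) : ℝ :=
  ‖contractA A (M i) Ψ‖ ^ 2

/-- The state `(⟨v_i| ⊗ I_B) |Ψ⟩ / √p_i` left on `B` after outcome `i` (meaningful for `p_i ≠ 0`). -/
def postState {A : Finset V} (M : Measurement A) (Ψ : Qubits V) (i : {v // v ∈ A} → Fin 2) :
    Qubits {v // v ∉ A} :=
  ((√(outcomeProb M Ψ i))⁻¹ : ℂ) • contractA A (M i) Ψ

end Bipartite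

/-! ### Graph states -/

section Graph

variable {V : Type*} [Fintype V] [DecidableEq V]

/-- The controlled-Z gate on the pair of qubits `e`: sign `-1` on the basis states in which
both qubits of `e` are `1`. -/
def CZ (e : Sym2 V) : QubitOp V :=
  Matrix.diagonal fun z => if ∀ v ∈ e, z v = 1 then -1 else 1

theorem CZ_commute (e f : Sym2 V) : Commute (CZ e) (CZ f) := by
  unfold CZ
  rw [Commute, SemiconjBy, Matrix.diagonal_mul_diagonal, Matrix.diagonal_mul_diagonal]
  simp only [mul_comm]

/-- The state `|+⟩^{⊗V}`, where `|+⟩ = (|0⟩ + |1⟩)/√2`. -/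
def plusAll (V : Type*) [Fintype V] : Qubits V :=
  WithLp.toLp 2 fun _ => ∏ _v : V, (1 / (√2 : ℂ))

/-- The graph state `|G⟩ = ∏_{e ∈ E} CZ_e |+⟩^{⊗V}`. -/
def graphState (G : SimpleGraph V) [DecidableRel G.Adj] : Qubits V :=
  applyOp (G.edgeFinset.noncommProd (fun e => CZ e) fun e _ f _ _ => CZ_commute e f) (plusAll V)

/-- The block `Γ_BA` of the adjacency matrix over `𝔽₂`, with rows in `B` and columns in `A`. -/
def gammaBA (G : SimpleGraph V) [DecidableRel G.Adj] (A : Finset V) :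
    Matrix {v // v ∉ A} {v // v ∈ A} (ZMod 2) :=
  (G.adjMatrix (ZMod 2)).submatrix (fun b => b.1) (fun a => a.1)

/-- The degree vector `D` of `G - A`: `D_b = 1` iff `b` has even degree in the subgraph of `G`
induced by the complement of `A`. -/
def degreeVec (G : SimpleGraph V) [DecidableRel G.Adj] (A : Finset V) : {v // v ∉ A} → ZMod 2 :=
  fun b => if Even ((G.induce {v | v ∉ A}).degree b) then 1 else 0

end Graph

end GraphTangle

end

/-! The amplitudes of a graph state are `2^(-|V|/2) (-1)^q(z)`, where `q = edgeForm G` is a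
quadratic form over `𝔽₂`. Across the bipartition, `q(x,y) = q_A(x) + q_B(y) + y·Γx`
(`edgeForm_glue`). By `edgeForm_glue_add_one`, flipping all bits of `B` together with the `σ_y`
signs produces the character `(-1)^(y·D)`, up to a sign independent of `y`
(`sgn_mul_graphState_glue_add_one`). The tilde therefore conjugates the reduced state by that
diagonal character.

If `D = Γx₀`, translating the sum over `A` by `x₀` absorbs the character, so `G_B` equals its tilde
and the fidelity is its trace. If there is no solution, `Γx + Γx' + D` never vanishes, and character
orthogonality on `B` kills both `ρ ρ̃` and `⟨φ|φ̃⟩` for every contraction `φ`.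

For maximal tangle, the vectors on `A` carry the sign of `q_A`, a Hadamard character and the phase
`i^(1·Γx)`. This phase compensates the sign `(-1)^(1·Γx)` left by the tilde; evenness of `|B|` makes
it invariant under `x ↦ x + x₀`. Each contracted vector is then an eigenvector of the tilde up to a
unit scalar. -/

noncomputable section

namespace GraphTangle

open scoped Fin.CommRing

/-! ### Signs -/

/-- The sign `(-1)^b` of a bit. -/
def sgn (b : Fin 2) : ℂ := if b = 0 then 1 else -1

@[simp] theorem sgn_zero : sgn 0 = 1 := rfl

@[simp] theorem sgn_one : sgn 1 = -1 := rfl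

theorem sgn_add (a b : Fin 2) : sgn (a + b) = sgn a * sgn b := by
  fin_cases a <;> fin_cases b <;> simp [sgn]

@[simp] theorem sgn_mul_self (a : Fin 2) : sgn a * sgn a = 1 := by
  fin_cases a <;> simp [sgn]

@[simp] theorem star_sgn (a : Fin 2) : star (sgn a) = sgn a := by
  fin_cases a <;> simp [sgn]

@[simp] theorem norm_sgn (a : Fin 2) : ‖sgn a‖ = 1 := by
  fin_cases a <;> simp [sgn]

theorem sgn_sum {ι : Type*} (s : Finset ι) (f : ι → Fin 2) :
    sgn (∑ i ∈ s, f i) = ∏ i ∈ s, sgn (f i) := by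
  classical
  induction s using Finset.induction_on with
  | empty => simp
  | insert a s ha ih => rw [Finset.sum_insert ha, Finset.prod_insert ha, sgn_add, ih]

/-- Flipping a coordinate where `u` is `1` negates every term, so the sum equals its own negative.
-/
theorem sum_sgn_dotProduct_of_ne_zero {ι : Type*} [Fintype ι] [DecidableEq ι] {u : ι → Fin 2}
    (hu : u ≠ 0) : ∑ y : ι → Fin 2, sgn (y ⬝ᵥ u) = 0 := by
  obtain ⟨i, hi⟩ := Function.ne_iff.1 hu
  have hi1 : u i = 1 := by
    have : ∀ b : Fin 2, b ≠ 0 → b = 1 := by decide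
    exact this _ hi
  have h := Equiv.sum_comp (Equiv.addRight (Pi.single i (1 : Fin 2))) (fun y => sgn (y ⬝ᵥ u))
  simp only [Equiv.coe_addRight, add_dotProduct, single_one_dotProduct, hi1, sgn_add, sgn_one,
    mul_neg, mul_one, Finset.sum_neg_distrib] at h
  linear_combination (-1 / 2 : ℂ) * h

theorem sum_sgn_dotProduct_zero {ι : Type*} [Fintype ι] [DecidableEq ι] :
    ∑ y : ι → Fin 2, sgn (y ⬝ᵥ (0 : ι → Fin 2)) = 2 ^ Fintype.card ι := by
  simp

/-! ### The quadratic form of a graph -/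

section Quadratic

variable {V : Type*} [Fintype V] [DecidableEq V]

/-- The number, modulo two, of edges of `G` both of whose ends carry the bit `1` in `z`. -/
def edgeForm (G : SimpleGraph V) [DecidableRel G.Adj] (z : V → Fin 2) : Fin 2 :=
  ∑ e ∈ G.edgeFinset, if ∀ v ∈ e, z v = 1 then 1 else 0

/-- Each edge has exactly two orientations, which form its fibre in the set of adjacent ordered
pairs. -/
theorem sum_edges_symmetrized (G : SimpleGraph V) [DecidableRel G.Adj] {R : Type*} [CommRing R]
    (f : Sym2 V → R) (g : V → V → R) (hf : ∀ i j, f s(i, j) = g i j + g j i) :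
    ∑ e ∈ G.edgeFinset, f e = ∑ i, ∑ j, if G.Adj i j then g i j else 0 := by
  rw [← Fintype.sum_prod_type' (f := fun i j => if G.Adj i j then g i j else 0),
    ← Finset.sum_filter]
  have hm : ∀ p ∈ (Finset.univ.filter fun p : V × V => G.Adj p.1 p.2),
      s(p.1, p.2) ∈ G.edgeFinset := by
    intro p hp
    simpa using hp
  rw [← Finset.sum_fiberwise_of_maps_to hm]
  refine Finset.sum_congr rfl fun e he => ?_
  induction e using Sym2.ind with
  | _ i j =>
    have hij : G.Adj i j := by simpa using he
    have : ((Finset.univ.filter fun p : V × V => G.Adj p.1 p.2).filter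
        fun p => s(p.1, p.2) = s(i, j)) = {(i, j), (j, i)} := by
      ext ⟨a, b⟩
      simp only [Finset.mem_filter, Finset.mem_univ, true_and, Sym2.eq_iff, Finset.mem_insert,
        Finset.mem_singleton, Prod.mk.injEq]
      constructor
      · exact fun h => h.2
      · rintro (⟨rfl, rfl⟩ | ⟨rfl, rfl⟩)
        · exact ⟨hij, Or.inl ⟨rfl, rfl⟩⟩
        · exact ⟨hij.symm, Or.inr ⟨rfl, rfl⟩⟩
    rw [this, Finset.sum_pair (by simpa using fun h => absurd h hij.ne), hf]

/-- Polarization: the adjacency form is the bilinear form attached to `edgeForm`. -/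
theorem edgeForm_add (G : SimpleGraph V) [DecidableRel G.Adj] (z w : V → Fin 2) :
    edgeForm G (z + w) =
      edgeForm G z + edgeForm G w + ∑ i, ∑ j, if G.Adj i j then z i * w j else 0 := by
  rw [← sum_edges_symmetrized G (fun e => (if ∀ v ∈ e, (z + w) v = 1 then 1 else 0)
    - (if ∀ v ∈ e, z v = 1 then 1 else 0) - (if ∀ v ∈ e, w v = 1 then 1 else 0))]
  · simp only [edgeForm, Finset.sum_sub_distrib]
    ring
  · intro i j
    simp only [Sym2.mem_iff, forall_eq_or_imp, forall_eq, Pi.add_apply]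
    -- On one edge this is an identity among four bits.
    generalize z i = a, z j = b, w i = c, w j = d
    revert a b c d
    decide

theorem plusAll_apply {V : Type*} [Fintype V] (z : V → Fin 2) : plusAll V z = ((√2)⁻¹ ^ Fintype.card V : ℝ) := by
  simp [plusAll]

theorem graphState_apply (G : SimpleGraph V) [DecidableRel G.Adj] (z : V → Fin 2) :
    graphState G z = ((√2)⁻¹ ^ Fintype.card V : ℝ) * sgn (edgeForm G z) := by
  have h : ∀ (s : Finset (Sym2 V)) (H),
      s.noncommProd (fun e => CZ e) H =
        Matrix.diagonal fun z : V → Fin 2 => sgn (∑ e ∈ s, if ∀ v ∈ e, z v = 1 then 1 else 0) := by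
    intro s
    induction s using Finset.induction_on with
    | empty => intro H; simp
    | insert a s ha ih =>
      intro H
      rw [Finset.noncommProd_insert_of_notMem _ _ _ _ ha, ih, CZ, Matrix.diagonal_mul_diagonal]
      congr 1
      funext z
      rw [Finset.sum_insert ha, sgn_add]
      congr 1
      split_ifs <;> simp
  have hG : graphState G = applyOp (Matrix.diagonal fun z => sgn (edgeForm G z)) (plusAll V) :=
    congrArg (applyOp · (plusAll V)) (h _ _)
  rw [hG]
  simp only [applyOp, Matrix.mulVec_diagonal, plusAll_apply]
  rw [mul_comm]

end Quadratic

/-! ### The tilde operation in coordinates -/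

section Tilde

variable {ι : Type*} [Fintype ι] [DecidableEq ι]

theorem sigmaY_apply (a b : Fin 2) :
    sigmaY a b = if b = a + 1 then -Complex.I * sgn a else 0 := by
  fin_cases a <;> fin_cases b <;> simp [sigmaY, sgn]

theorem sigmaYAll_apply {ι : Type*} [Fintype ι] (y w : ι → Fin 2) :
    sigmaYAll ι y w =
      if w = y + 1 then (-Complex.I) ^ Fintype.card ι * sgn (∑ i, y i) else 0 := by
  simp only [sigmaYAll, Matrix.of_apply, sigmaY_apply]
  split_ifs with h
  · subst h
    simp [Finset.prod_mul_distrib, sgn_sum, -neg_mul]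
  · obtain ⟨i, hi⟩ := Function.ne_iff.1 h
    exact Finset.prod_eq_zero (Finset.mem_univ i) (if_neg hi)

/-- Reading the sign off the column index gives `i^n`, which cancels the `(-i)^n` of the row version
when both factors of `tildeOp` are expanded. -/
theorem sigmaYAll_apply' {ι : Type*} [Fintype ι] (y w : ι → Fin 2) :
    sigmaYAll ι y w =
      if y = w + 1 then Complex.I ^ Fintype.card ι * sgn (∑ i, w i) else 0 := by
  have key : ∀ a b : Fin 2, sigmaY a b = if a = b + 1 then Complex.I * sgn b else 0 := by
    intro a b
    fin_cases a <;> fin_cases b <;> simp [sigmaY, sgn]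
  simp only [sigmaYAll, Matrix.of_apply, key]
  split_ifs with h
  · subst h
    simp [Finset.prod_mul_distrib, sgn_sum]
  · obtain ⟨i, hi⟩ := Function.ne_iff.1 h
    exact Finset.prod_eq_zero (Finset.mem_univ i) (if_neg hi)

theorem tildeVec_apply (ψ : Qubits ι) (y : ι → Fin 2) :
    tildeVec ψ y = (-Complex.I) ^ Fintype.card ι * sgn (∑ i, y i) * star (ψ (y + 1)) := by
  simp [tildeVec, applyOp, Matrix.mulVec, dotProduct, sigmaYAll_apply]

theorem tildeOp_apply (ρ : QubitOp ι) (y w : ι → Fin 2) :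
    tildeOp ρ y w = sgn (∑ i, y i) * sgn (∑ i, w i) * star (ρ (y + 1) (w + 1)) := by
  have hI : (-Complex.I) ^ Fintype.card ι * Complex.I ^ Fintype.card ι = 1 := by
    rw [← mul_pow]; simp
  have h : tildeOp ρ y w = ((-Complex.I) ^ Fintype.card ι * sgn (∑ i, y i)) *
      star (ρ (y + 1) (w + 1)) * (Complex.I ^ Fintype.card ι * sgn (∑ i, w i)) := by
    rw [tildeOp, Matrix.mul_apply, Finset.sum_eq_single (w + 1)]
    · rw [Matrix.mul_apply, Finset.sum_eq_single (y + 1), sigmaYAll_apply, sigmaYAll_apply',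
        if_pos rfl, if_pos rfl, Matrix.map_apply]
      · intro b _ hb
        rw [sigmaYAll_apply, if_neg hb, zero_mul]
      · simp
    · intro b _ hb
      rw [sigmaYAll_apply', if_neg hb, mul_zero]
    · simp
  rw [h]
  linear_combination sgn (∑ i, y i) * sgn (∑ i, w i) * star (ρ (y + 1) (w + 1)) * hI

theorem tangle_smul (c : ℂ) (ψ : Qubits ι) : tangle (c • ψ) = ‖c‖ ^ 2 * tangle ψ := by
  have h : tildeVec (c • ψ) = star c • tildeVec ψ := by
    ext y
    simp only [tildeVec_apply, PiLp.smul_apply, smul_eq_mul, star_mul']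
    ring
  rw [tangle, h, inner_smul_left, inner_smul_right, norm_mul, norm_mul, tangle]
  simp
  ring

/-- A vector that agrees with its tilde up to a unit scalar has maximal tangle. -/
theorem tangle_eq_norm_sq_of_tildeVec_eq_smul {ψ : Qubits ι} {c : ℂ} (hc : ‖c‖ = 1)
    (h : tildeVec ψ = c • ψ) : tangle ψ = ‖ψ‖ ^ 2 := by
  rw [tangle, h, inner_smul_right, norm_mul, hc, one_mul, inner_self_eq_norm_sq_to_K]
  simp

end Tilde

/-! ### Fidelity -/

section Fidelity

variable {ι : Type*} [Fintype ι] [DecidableEq ι]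

theorem fidelity_self {ρ : QubitOp ι} (hρ : 0 ≤ ρ) : fidelity ρ ρ = ρ.trace := by
  have h : CFC.sqrt ρ * ρ * CFC.sqrt ρ = ρ * ρ := by
    have h2 := CFC.sqrt_mul_sqrt_self ρ hρ
    calc CFC.sqrt ρ * ρ * CFC.sqrt ρ
        = CFC.sqrt ρ * (CFC.sqrt ρ * CFC.sqrt ρ) * CFC.sqrt ρ := by rw [h2]
      _ = (CFC.sqrt ρ * CFC.sqrt ρ) * (CFC.sqrt ρ * CFC.sqrt ρ) := by simp only [mul_assoc]
      _ = ρ * ρ := by rw [h2]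
  rw [fidelity, h, CFC.sqrt_mul_self ρ hρ]

/-- With `s = √ρ`, one has `(sσ)ᴴ(sσ) = σᴴρσ = 0`, hence `sσ = 0`. -/
theorem fidelity_eq_zero_of_mul_eq_zero {ρ σ : QubitOp ι} (hρ : 0 ≤ ρ) (h : ρ * σ = 0) :
    fidelity ρ σ = 0 := by
  have hs : (CFC.sqrt ρ)ᴴ = CFC.sqrt ρ :=
    (Matrix.nonneg_iff_posSemidef.1 (CFC.sqrt_nonneg ρ)).isHermitian
  have h0 : CFC.sqrt ρ * σ = 0 := by
    rw [← Matrix.conjTranspose_mul_self_eq_zero, Matrix.conjTranspose_mul, hs, mul_assoc,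
      ← mul_assoc (CFC.sqrt ρ), CFC.sqrt_mul_sqrt_self ρ hρ, h, mul_zero]
  rw [fidelity, h0, zero_mul, CFC.sqrt_zero, Matrix.trace_zero]

end Fidelity

/-! ### Graph states across a bipartition -/

section Bipartite

variable {V : Type*} [Fintype V] [DecidableEq V]

theorem reducedB_density_nonneg (A : Finset V) (Ψ : Qubits V) : 0 ≤ reducedB A (density Ψ) := by
  rw [Matrix.nonneg_iff_posSemidef]
  have h : reducedB A (density Ψ) =
      (Matrix.of fun y x => Ψ (glue A x y)) * (Matrix.of fun y x => Ψ (glue A x y))ᴴ := by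
    ext y w
    simp [reducedB, density, Matrix.mul_apply]
  rw [h]
  exact Matrix.posSemidef_self_mul_conjTranspose _

theorem glue_add {V : Type*} [DecidableEq V] (A : Finset V)
    (x x' : {v // v ∈ A} → Fin 2) (y y' : {v // v ∉ A} → Fin 2) :
    glue A (x + x') (y + y') = glue A x y + glue A x' y' := by
  funext v
  by_cases h : v ∈ A <;> simp [glue, h]

@[simp] theorem glue_mem {V : Type*} [DecidableEq V] (A : Finset V)
    (x : {v // v ∈ A} → Fin 2) (y : {v // v ∉ A} → Fin 2)
    (a : {v // v ∈ A}) : glue A x y a = x a := by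
  simp [glue, a.2]

@[simp] theorem glue_notMem {V : Type*} [DecidableEq V] (A : Finset V)
    (x : {v // v ∈ A} → Fin 2) (y : {v // v ∉ A} → Fin 2)
    (b : {v // v ∉ A}) : glue A x y b = y b := by
  simp [glue, b.2]

/-- The `B`-by-`A` block of the adjacency matrix, with entries in the type of bits. -/
def crossBlock (G : SimpleGraph V) [DecidableRel G.Adj] (A : Finset V) :
    Matrix {v // v ∉ A} {v // v ∈ A} (Fin 2) :=
  Matrix.of fun b a => if G.Adj b a then 1 else 0

/-- The parity vector of the degrees in `G - A`, complemented. -/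
def parityVec (G : SimpleGraph V) [DecidableRel G.Adj] (A : Finset V) : {v // v ∉ A} → Fin 2 :=
  fun b => 1 + ∑ b' : {v // v ∉ A}, if G.Adj b b' then 1 else 0

theorem degreeVec_eq_parityVec (G : SimpleGraph V) [DecidableRel G.Adj] (A : Finset V) :
    degreeVec G A = parityVec G A := by
  funext b
  have hdeg : (∑ b' : {v // v ∉ A}, if G.Adj b b' then (1 : Fin 2) else 0) =
      (((G.induce {v | v ∉ A}).degree b : ℕ) : Fin 2) := by
    rw [Finset.sum_boole, ← SimpleGraph.card_neighborFinset_eq_degree]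
    congr 2
    ext b'
    simp
  have hcast : ∀ n : ℕ, (1 : Fin 2) + (n : Fin 2) = if Even n then 1 else 0 := by
    intro n
    induction n with
    | zero => simp
    | succ n ih =>
      rw [Nat.cast_succ, ← add_assoc, ih]
      by_cases h : Even n <;> simp [h, Nat.even_add_one]
  rw [parityVec, hdeg, hcast]
  rfl

theorem exists_gammaBA_mulVec_eq_iff (G : SimpleGraph V) [DecidableRel G.Adj] (A : Finset V) :
    (∃ x : {v // v ∈ A} → ZMod 2, gammaBA G A *ᵥ x = degreeVec G A) ↔
      ∃ x : {v // v ∈ A} → Fin 2, crossBlock G A *ᵥ x = parityVec G A := by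
  rw [degreeVec_eq_parityVec]
  -- `ZMod 2` unfolds to `Fin 2`, so both systems are definitionally the same.
  exact Iff.rfl

theorem edgeForm_glue (G : SimpleGraph V) [DecidableRel G.Adj] (A : Finset V)
    (x : {v // v ∈ A} → Fin 2) (y : {v // v ∉ A} → Fin 2) :
    edgeForm G (glue A x y) =
      edgeForm G (glue A x 0) + edgeForm G (glue A 0 y) + y ⬝ᵥ (crossBlock G A *ᵥ x) := by
  have h : glue A x y = glue A 0 y + glue A x 0 := by rw [← glue_add, zero_add, add_zero]
  rw [h, edgeForm_add]
  simp only [← Fintype.sum_subtype_add_sum_subtype (· ∈ A), glue_mem, glue_notMem]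
  simp only [Pi.zero_apply, zero_mul, mul_zero, ite_self, Finset.sum_const_zero, zero_add,
    add_zero, dotProduct, Matrix.mulVec, crossBlock, Matrix.of_apply, Finset.mul_sum, ite_mul,
    one_mul, mul_ite]
  rw [add_comm (edgeForm G (glue A 0 y))]
  congr!

/-- This is where `D` arises: polarizing against the all-ones vector of `B` yields the degrees in `G
- A`, and the Pauli sign `∑ y` complements their parities. -/
theorem edgeForm_glue_add_one (G : SimpleGraph V) [DecidableRel G.Adj] (A : Finset V)
    (y : {v // v ∉ A} → Fin 2) :
    (∑ i, y i) + edgeForm G (glue A 0 (y + 1)) =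
      edgeForm G (glue A 0 1) + edgeForm G (glue A 0 y) + y ⬝ᵥ parityVec G A := by
  have h : glue A 0 (y + 1) = glue A 0 y + glue A 0 1 := by rw [← glue_add, zero_add]
  rw [h, edgeForm_add]
  simp only [← Fintype.sum_subtype_add_sum_subtype (· ∈ A), glue_mem, glue_notMem]
  simp only [Pi.zero_apply, Pi.one_apply, mul_zero, ite_self, Finset.sum_const_zero,
    zero_add, mul_one, dotProduct, parityVec, mul_add, Finset.sum_add_distrib, Finset.mul_sum,
    mul_ite]
  ring

end Bipartite

/-! ### The reduced state, its tilde, and the vanishing of the tangle -/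

section GraphState

variable {V : Type*} [Fintype V] [DecidableEq V] (G : SimpleGraph V) [DecidableRel G.Adj]
  (A : Finset V)

/-- The modulus `2^{-|V|/2}` of the amplitudes of a graph state. -/
def graphAmp (V : Type*) [Fintype V] : ℂ := ((√2)⁻¹ ^ Fintype.card V : ℝ)

theorem star_graphAmp (V : Type*) [Fintype V] : star (graphAmp V) = graphAmp V :=
  Complex.conj_ofReal _

theorem ofReal_inv_sqrt_two_pow_sq (n : ℕ) :
    (((√2)⁻¹ ^ n : ℝ) : ℂ) * (((√2)⁻¹ ^ n : ℝ) : ℂ) * 2 ^ n = 1 := by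
  have h : ((√2)⁻¹ ^ n * (√2)⁻¹ ^ n * 2 ^ n : ℝ) = 1 := by
    rw [← mul_pow, ← mul_pow, ← mul_inv, Real.mul_self_sqrt (by norm_num)]
    norm_num
  exact_mod_cast h

theorem graphState_glue (x : {v // v ∈ A} → Fin 2) (y : {v // v ∉ A} → Fin 2) :
    graphState G (glue A x y) = graphAmp V * sgn (edgeForm G (glue A x 0)) *
      sgn (edgeForm G (glue A 0 y)) * sgn (y ⬝ᵥ (crossBlock G A *ᵥ x)) := by
  rw [graphState_apply, edgeForm_glue, sgn_add, sgn_add, graphAmp]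
  ring

theorem star_graphState (z : V → Fin 2) : star (graphState G z) = graphState G z := by
  rw [graphState_apply, star_mul', star_sgn]
  congr 1
  exact Complex.conj_ofReal _

/-- Flipping all the bits of `B` multiplies the amplitudes of a graph state by a character. -/
theorem sgn_mul_graphState_glue_add_one (x : {v // v ∈ A} → Fin 2) (y : {v // v ∉ A} → Fin 2) :
    sgn (∑ i, y i) * graphState G (glue A x (y + 1)) =
      sgn (edgeForm G (glue A 0 1)) * sgn (∑ i, (crossBlock G A *ᵥ x) i) *
        sgn (y ⬝ᵥ parityVec G A) * graphState G (glue A x y) := by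
  have h := congrArg sgn (edgeForm_glue_add_one G A y)
  simp only [sgn_add] at h
  rw [graphState_glue, graphState_glue, add_dotProduct, one_dotProduct, sgn_add]
  linear_combination graphAmp V * sgn (edgeForm G (glue A x 0)) *
    sgn (y ⬝ᵥ (crossBlock G A *ᵥ x)) * sgn (∑ i, (crossBlock G A *ᵥ x) i) * h

theorem reducedB_graphState_apply (y w : {v // v ∉ A} → Fin 2) :
    reducedB A (density (graphState G)) y w =
      graphAmp V * graphAmp V * sgn (edgeForm G (glue A 0 y)) * sgn (edgeForm G (glue A 0 w)) *
        ∑ x, sgn ((y + w) ⬝ᵥ (crossBlock G A *ᵥ x)) := by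
  rw [reducedB, Matrix.of_apply, Finset.mul_sum]
  refine Finset.sum_congr rfl fun x _ => ?_
  rw [density, Matrix.of_apply, star_graphState, graphState_glue, graphState_glue, add_dotProduct,
    sgn_add]
  linear_combination graphAmp V * graphAmp V * sgn (edgeForm G (glue A 0 y)) *
    sgn (edgeForm G (glue A 0 w)) * sgn (y ⬝ᵥ (crossBlock G A *ᵥ x)) *
    sgn (w ⬝ᵥ (crossBlock G A *ᵥ x)) * sgn_mul_self (edgeForm G (glue A x 0))

theorem trace_reducedB_graphState : (reducedB A (density (graphState G))).trace = 1 := by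
  have h : ∀ y, reducedB A (density (graphState G)) y y =
      graphAmp V * graphAmp V * 2 ^ Fintype.card {v // v ∈ A} := by
    intro y
    have hy : y + y = 0 := by
      funext i
      have : ∀ b : Fin 2, b + b = 0 := by decide
      exact this _
    rw [reducedB_graphState_apply, hy]
    simp only [zero_dotProduct, sgn_zero, Finset.sum_const, Finset.card_univ, Fintype.card_pi,
      Fintype.card_fin, Finset.prod_const, nsmul_eq_mul]
    push_cast
    linear_combination graphAmp V * graphAmp V * 2 ^ Fintype.card {v // v ∈ A} *
      sgn_mul_self (edgeForm G (glue A 0 y))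
  have hc : Fintype.card V = Fintype.card {v // v ∈ A} + Fintype.card {v // v ∉ A} := by
    rw [Fintype.card_subtype_compl]
    have := Fintype.card_subtype_le (· ∈ A)
    simp only [Fintype.card_coe] at *
    omega
  have h1 := ofReal_inv_sqrt_two_pow_sq (Fintype.card V)
  simp only [Matrix.trace, Matrix.diag, h, Finset.sum_const, Finset.card_univ, Fintype.card_pi,
    Fintype.card_fin, Finset.prod_const, nsmul_eq_mul, graphAmp]
  rw [← h1, hc, pow_add (2 : ℂ)]
  push_cast
  ring

/-- The signs independent of `y` and `w` occur once for the row and once for the column, so they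
square to one. -/
theorem tildeOp_reducedB_graphState_apply (y w : {v // v ∉ A} → Fin 2) :
    tildeOp (reducedB A (density (graphState G))) y w =
      sgn (y ⬝ᵥ parityVec G A) * sgn (w ⬝ᵥ parityVec G A) *
        reducedB A (density (graphState G)) y w := by
  rw [tildeOp_apply]
  simp only [reducedB, density, Matrix.of_apply, star_sum, star_mul', star_graphState,
    Finset.mul_sum]
  refine Finset.sum_congr rfl fun x _ => ?_
  have hy := sgn_mul_graphState_glue_add_one G A x y
  have hw := sgn_mul_graphState_glue_add_one G A x w
  calc _ = (sgn (∑ i, y i) * graphState G (glue A x (y + 1))) *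
        (sgn (∑ i, w i) * graphState G (glue A x (w + 1))) := by ring
    _ = (sgn (edgeForm G (glue A 0 1)) * sgn (edgeForm G (glue A 0 1))) *
        (sgn (∑ i, (crossBlock G A *ᵥ x) i) * sgn (∑ i, (crossBlock G A *ᵥ x) i)) *
        (sgn (y ⬝ᵥ parityVec G A) * sgn (w ⬝ᵥ parityVec G A) *
          (graphState G (glue A x y) * graphState G (glue A x w))) := by rw [hy, hw]; ring
    _ = _ := by rw [sgn_mul_self, sgn_mul_self, one_mul, one_mul]

theorem tildeOp_reducedB_graphState_eq_self {x₀ : {v // v ∈ A} → Fin 2}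
    (hx₀ : crossBlock G A *ᵥ x₀ = parityVec G A) :
    tildeOp (reducedB A (density (graphState G))) = reducedB A (density (graphState G)) := by
  ext y w
  rw [tildeOp_reducedB_graphState_apply, reducedB_graphState_apply, ← hx₀]
  -- Translation by `x₀` multiplies the sum by `(-1)^((y+w)·D)`.
  conv_rhs => rw [← Equiv.sum_comp (Equiv.addRight x₀)]
  simp only [Equiv.coe_addRight, Matrix.mulVec_add, dotProduct_add, add_dotProduct, sgn_add,
    ← Finset.sum_mul]
  ring

theorem crossBlock_mulVec_add_ne {x x' : {v // v ∈ A} → Fin 2}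
    (hno : ¬ ∃ x : {v // v ∈ A} → Fin 2, crossBlock G A *ᵥ x = parityVec G A) :
    crossBlock G A *ᵥ x + crossBlock G A *ᵥ x' + parityVec G A ≠ 0 := by
  intro h
  refine hno ⟨x + x', ?_⟩
  rw [Matrix.mulVec_add]
  funext i
  have h2 : ∀ a b : Fin 2, a + b = 0 → a = b := by decide
  exact h2 _ _ (congrFun h i)

theorem reducedB_mul_tildeOp_graphState_eq_zero
    (hno : ¬ ∃ x : {v // v ∈ A} → Fin 2, crossBlock G A *ᵥ x = parityVec G A) :
    reducedB A (density (graphState G)) * tildeOp (reducedB A (density (graphState G))) = 0 := by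
  ext y w
  rw [Matrix.mul_apply, Matrix.zero_apply]
  simp only [tildeOp_reducedB_graphState_apply, reducedB_graphState_apply]
  set c := graphAmp V with hc
  have key : ∀ u : {v // v ∉ A} → Fin 2,
      c * c * sgn (edgeForm G (glue A 0 y)) * sgn (edgeForm G (glue A 0 u)) *
          (∑ x, sgn ((y + u) ⬝ᵥ (crossBlock G A *ᵥ x))) *
        (sgn (u ⬝ᵥ parityVec G A) * sgn (w ⬝ᵥ parityVec G A) *
          (c * c * sgn (edgeForm G (glue A 0 u)) * sgn (edgeForm G (glue A 0 w)) *
            ∑ x, sgn ((u + w) ⬝ᵥ (crossBlock G A *ᵥ x)))) =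
      ∑ x, ∑ x', c * c * c * c * sgn (edgeForm G (glue A 0 y)) * sgn (edgeForm G (glue A 0 w)) *
        sgn (w ⬝ᵥ parityVec G A) * sgn (y ⬝ᵥ (crossBlock G A *ᵥ x)) *
        sgn (w ⬝ᵥ (crossBlock G A *ᵥ x')) *
        sgn (u ⬝ᵥ (crossBlock G A *ᵥ x + crossBlock G A *ᵥ x' + parityVec G A)) := by
    intro u
    have h : ∀ (a b p s t : ℂ), a * (sgn (edgeForm G (glue A 0 u))) * s *
        (p * (b * sgn (edgeForm G (glue A 0 u)) * t)) = a * b * p * (s * t) := by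
      intro a b p s t
      linear_combination a * s * p * b * t * sgn_mul_self (edgeForm G (glue A 0 u))
    have h' : c * c * sgn (edgeForm G (glue A 0 u)) * sgn (edgeForm G (glue A 0 w)) =
      (c * c * sgn (edgeForm G (glue A 0 w))) * sgn (edgeForm G (glue A 0 u)) := by ring
    rw [h', h, Finset.sum_mul_sum, Finset.mul_sum]
    refine Finset.sum_congr rfl fun x _ => ?_
    rw [Finset.mul_sum]
    refine Finset.sum_congr rfl fun x' _ => ?_
    simp only [add_dotProduct, dotProduct_add, sgn_add]
    ring
  rw [Finset.sum_congr rfl fun u _ => key u, Finset.sum_comm]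
  refine Finset.sum_eq_zero fun x _ => ?_
  rw [Finset.sum_comm]
  refine Finset.sum_eq_zero fun x' _ => ?_
  rw [← Finset.mul_sum, sum_sgn_dotProduct_of_ne_zero (crossBlock_mulVec_add_ne G A hno), mul_zero]

/-- Contraction conjugates `v` and the tilde conjugates it back, so `v` appears here unconjugated.
-/
theorem tildeVec_contractA_apply (v : Qubits {v // v ∈ A}) (y : {v // v ∉ A} → Fin 2) :
    tildeVec (contractA A v (graphState G)) y =
      (-Complex.I) ^ Fintype.card {v // v ∉ A} * sgn (edgeForm G (glue A 0 1)) *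
        ∑ x, v x * sgn (∑ i, (crossBlock G A *ᵥ x) i) * sgn (y ⬝ᵥ parityVec G A) *
          graphState G (glue A x y) := by
  rw [tildeVec_apply]
  simp only [contractA, star_sum, star_mul', star_star, star_graphState, Finset.mul_sum]
  refine Finset.sum_congr rfl fun x _ => ?_
  linear_combination (-Complex.I) ^ Fintype.card {v // v ∉ A} * v x *
    sgn_mul_graphState_glue_add_one G A x y

/-- In `⟨φ|φ̃⟩` the signs `q_B(y)` cancel, leaving for each pair `x, x'` a nontrivial character
summed over `B`. No property of `v` is needed, so entangled and product measurements are covered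
alike. -/
theorem tangle_contractA_graphState_eq_zero
    (hno : ¬ ∃ x : {v // v ∈ A} → Fin 2, crossBlock G A *ᵥ x = parityVec G A)
    (v : Qubits {v // v ∈ A}) : tangle (contractA A v (graphState G)) = 0 := by
  rw [tangle, norm_eq_zero, PiLp.inner_apply]
  have key : ∀ y, inner ℂ (contractA A v (graphState G) y)
      (tildeVec (contractA A v (graphState G)) y) =
      ∑ x, ∑ x', (-Complex.I) ^ Fintype.card {v // v ∉ A} * sgn (edgeForm G (glue A 0 1)) *
        graphAmp V * graphAmp V * v x * v x' * sgn (∑ i, (crossBlock G A *ᵥ x) i) *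
        sgn (edgeForm G (glue A x 0)) * sgn (edgeForm G (glue A x' 0)) *
        sgn (y ⬝ᵥ (crossBlock G A *ᵥ x + crossBlock G A *ᵥ x' + parityVec G A)) := by
    intro y
    rw [tildeVec_contractA_apply, RCLike.inner_apply', starRingEnd_apply]
    simp only [contractA, star_sum, star_mul', star_star, star_graphState]
    rw [mul_left_comm, mul_comm (∑ x, v x * _), Finset.sum_mul_sum, Finset.mul_sum]
    refine Finset.sum_congr rfl fun x _ => ?_
    rw [Finset.mul_sum]
    refine Finset.sum_congr rfl fun x' _ => ?_
    simp only [dotProduct_add, sgn_add, graphState_glue]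
    linear_combination (-Complex.I) ^ Fintype.card {v // v ∉ A} * sgn (edgeForm G (glue A 0 1)) *
        graphAmp V * graphAmp V * v x * v x' * sgn (∑ i, (crossBlock G A *ᵥ x) i) *
        sgn (edgeForm G (glue A x 0)) * sgn (edgeForm G (glue A x' 0)) *
        sgn (y ⬝ᵥ (crossBlock G A *ᵥ x)) * sgn (y ⬝ᵥ (crossBlock G A *ᵥ x')) *
        sgn (y ⬝ᵥ parityVec G A) * sgn_mul_self (edgeForm G (glue A 0 y))
  rw [Finset.sum_congr rfl fun y _ => key y, Finset.sum_comm]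
  refine Finset.sum_eq_zero fun x _ => ?_
  rw [Finset.sum_comm]
  refine Finset.sum_eq_zero fun x' _ => ?_
  rw [← Finset.mul_sum, sum_sgn_dotProduct_of_ne_zero (crossBlock_mulVec_add_ne G A hno), mul_zero]

end GraphState

/-! ### A measurement attaining maximal tangle -/

section Measurement

variable {V : Type*} [Fintype V] [DecidableEq V] (G : SimpleGraph V) [DecidableRel G.Adj]
  (A : Finset V)

/-- The phase `i^b` of a bit. -/
def bitPhase (b : Fin 2) : ℂ := if b = 0 then 1 else Complex.I

/-- The phase is a square root of the sign, so absorbing the sign conjugates it, matching the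
conjugated vector in a contraction. -/
theorem bitPhase_mul_sgn (b : Fin 2) : bitPhase b * sgn b = star (bitPhase b) := by
  fin_cases b <;> simp [bitPhase, sgn]

theorem star_bitPhase_mul_self (b : Fin 2) : star (bitPhase b) * bitPhase b = 1 := by
  fin_cases b <;> simp [bitPhase]

/-- The graph-adapted basis vectors on `A`: signed Hadamard vectors, twisted by the phase
`i^{1ᵀ Γ x}`. -/
def adaptedVec (u : {v // v ∈ A} → Fin 2) : Qubits {v // v ∈ A} :=
  WithLp.toLp 2 fun x => graphAmp {v // v ∈ A} * sgn (edgeForm G (glue A x 0)) * sgn (x ⬝ᵥ u) *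
    bitPhase (∑ i, (crossBlock G A *ᵥ x) i)

theorem orthonormal_adaptedVec : Orthonormal ℂ (adaptedVec G A) := by
  rw [orthonormal_iff_ite]
  intro u u'
  have key : ∀ x, inner ℂ (adaptedVec G A u x) (adaptedVec G A u' x) =
      graphAmp {v // v ∈ A} * graphAmp {v // v ∈ A} * sgn (x ⬝ᵥ (u + u')) := by
    intro x
    rw [RCLike.inner_apply', starRingEnd_apply]
    simp only [adaptedVec, star_mul', star_sgn, star_graphAmp, dotProduct_add, sgn_add]
    have h1 := sgn_mul_self (edgeForm G (glue A x 0))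
    have h2 := star_bitPhase_mul_self (∑ i, (crossBlock G A *ᵥ x) i)
    calc _ = graphAmp {v // v ∈ A} * graphAmp {v // v ∈ A} * (sgn (x ⬝ᵥ u) * sgn (x ⬝ᵥ u')) *
        (sgn (edgeForm G (glue A x 0)) * sgn (edgeForm G (glue A x 0))) *
        (star (bitPhase (∑ i, (crossBlock G A *ᵥ x) i)) *
          bitPhase (∑ i, (crossBlock G A *ᵥ x) i)) := by ring
      _ = _ := by rw [h1, h2, mul_one, mul_one]
  rw [PiLp.inner_apply, Finset.sum_congr rfl fun x _ => key x, ← Finset.mul_sum]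
  split_ifs with h
  · subst h
    have hu : u + u = 0 := by
      funext i
      have : ∀ b : Fin 2, b + b = 0 := by decide
      exact this _
    rw [hu, sum_sgn_dotProduct_zero]
    exact ofReal_inv_sqrt_two_pow_sq _
  · rw [sum_sgn_dotProduct_of_ne_zero, mul_zero]
    intro h0
    refine h (funext fun i => ?_)
    have h2 : ∀ a b : Fin 2, a + b = 0 → a = b := by decide
    exact h2 _ _ (congrFun h0 i)

theorem exists_measurement_adaptedVec :
    ∃ M : Measurement A, ∀ u, M u = adaptedVec G A u := by
  have h : Orthonormal ℂ (Set.univ.domRestrict (adaptedVec G A)) :=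
    (orthonormal_adaptedVec G A).comp _ Subtype.val_injective
  obtain ⟨M, hM⟩ := h.exists_orthonormalBasis_extension_of_card_eq (by simp)
  exact ⟨M, fun u => hM u (Set.mem_univ u)⟩

/-- Taking `y = 1` in the flip identity gives `1·D = |B|` modulo two. Evenness of `|B|` enters the
proof through this fact. -/
theorem sum_parityVec (hB : Even (Fintype.card {v // v ∉ A})) : ∑ i, parityVec G A i = 0 := by
  have h := edgeForm_glue_add_one G A 1
  have h2 : ∀ b : Fin 2, b + b = 0 := by decide
  have h11 : (1 : {v // v ∉ A} → Fin 2) + 1 = 0 := funext fun _ => h2 1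
  have h0 : edgeForm G (glue A 0 0) = 0 := by
    have hz : glue A 0 0 = 0 := by
      funext v
      by_cases hv : v ∈ A <;> simp [glue, hv]
    have h3 := edgeForm_add G 0 0
    simpa [h2, hz] using h3
  obtain ⟨k, hk⟩ := hB
  rw [h11, h0, h2, one_dotProduct, zero_add, add_zero] at h
  rw [← h]
  simp only [Pi.one_apply, Finset.sum_const, Finset.card_univ, hk, nsmul_eq_mul, mul_one,
    Nat.cast_add, h2]

theorem tildeVec_contractA_adaptedVec (hB : Even (Fintype.card {v // v ∉ A}))
    {x₀ : {v // v ∈ A} → Fin 2} (hx₀ : crossBlock G A *ᵥ x₀ = parityVec G A)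
    (u : {v // v ∈ A} → Fin 2) :
    tildeVec (contractA A (adaptedVec G A u) (graphState G)) =
      ((-Complex.I) ^ Fintype.card {v // v ∉ A} * sgn (edgeForm G (glue A 0 1)) *
        sgn (x₀ ⬝ᵥ u)) • contractA A (adaptedVec G A u) (graphState G) := by
  ext y
  rw [tildeVec_contractA_apply, PiLp.smul_apply, smul_eq_mul, mul_assoc (_ * _)]
  congr 1
  simp only [contractA]
  -- After this shift the two sums agree termwise: `(-1)^(y·D)` comes from `Γx₀ = D`, and
  -- `(-1)^(x₀·u)` is cancelled by the eigenvalue.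
  conv_rhs => rw [← Equiv.sum_comp (Equiv.addRight x₀)]
  rw [Finset.mul_sum]
  refine Finset.sum_congr rfl fun x _ => ?_
  have hsum : ∑ i, (crossBlock G A *ᵥ (x + x₀)) i = ∑ i, (crossBlock G A *ᵥ x) i := by
    rw [Matrix.mulVec_add, hx₀]
    simp only [Pi.add_apply, Finset.sum_add_distrib, sum_parityVec G A hB, add_zero]
  simp only [Equiv.coe_addRight, adaptedVec, star_mul', star_sgn, star_graphAmp, hsum,
    graphState_glue, ← bitPhase_mul_sgn]
  rw [Matrix.mulVec_add, hx₀, dotProduct_add, add_dotProduct, sgn_add, sgn_add]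
  have h1 := sgn_mul_self (edgeForm G (glue A x 0))
  have h2 := sgn_mul_self (edgeForm G (glue A (x + x₀) 0))
  have h3 := sgn_mul_self (x₀ ⬝ᵥ u)
  generalize sgn (edgeForm G (glue A x 0)) = s at *
  generalize sgn (edgeForm G (glue A (x + x₀) 0)) = t at *
  generalize sgn (x₀ ⬝ᵥ u) = r at *
  generalize bitPhase (∑ i, (crossBlock G A *ᵥ x) i) = p
  generalize sgn (∑ i, (crossBlock G A *ᵥ x) i) = q
  have hst : s * s = r * r * (t * t) := by rw [h1, h2, h3, one_mul]
  linear_combination graphAmp {v // v ∈ A} * graphAmp V * sgn (x ⬝ᵥ u) * p * q *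
    sgn (y ⬝ᵥ parityVec G A) * sgn (edgeForm G (glue A 0 y)) *
    sgn (y ⬝ᵥ (crossBlock G A *ᵥ x)) * hst

theorem tangle_postState (M : Measurement A) (Ψ : Qubits V) (i : {v // v ∈ A} → Fin 2) :
    tangle (postState M Ψ i) = (outcomeProb M Ψ i)⁻¹ * tangle (contractA A (M i) Ψ) := by
  have hp : 0 ≤ outcomeProb M Ψ i := sq_nonneg _
  rw [postState, tangle_smul, norm_inv, inv_pow, Complex.norm_real, Real.norm_eq_abs, sq_abs,
    Real.sq_sqrt hp]

end Measurement

end GraphTangle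
end

open GraphTangle in
theorem mainTheorem2 {V : Type*} [Fintype V] [DecidableEq V]
    (G : SimpleGraph V) [DecidableRel G.Adj] (A : Finset V)
    (hB : Even (Fintype.card {v // v ∉ A})) :
    -- the fidelity is `1` or `0` according to solvability of `Γ_BA x = D`
    ((∃ x : {v // v ∈ A} → ZMod 2, gammaBA G A *ᵥ x = degreeVec G A) →
      fidelity (reducedB A (density (graphState G)))
        (tildeOp (reducedB A (density (graphState G)))) = 1) ∧
    ((¬ ∃ x : {v // v ∈ A} → ZMod 2, gammaBA G A *ᵥ x = degreeVec G A) →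
      fidelity (reducedB A (density (graphState G)))
        (tildeOp (reducedB A (density (graphState G)))) = 0) ∧
    -- no solution: every measurement on `A` yields only `τ = 0` states
    ((¬ ∃ x : {v // v ∈ A} → ZMod 2, gammaBA G A *ᵥ x = degreeVec G A) →
      ∀ (M : Measurement A) (i : {v // v ∈ A} → Fin 2),
        outcomeProb M (graphState G) i ≠ 0 → tangle (postState M (graphState G) i) = 0) ∧
    -- a solution: some measurement on `A` yields only `τ = 1` states
    ((∃ x : {v // v ∈ A} → ZMod 2, gammaBA G A *ᵥ x = degreeVec G A) →
      ∃ M : Measurement A, ∀ i : {v // v ∈ A} → Fin 2,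
        outcomeProb M (graphState G) i ≠ 0 → tangle (postState M (graphState G) i) = 1) := by
  rw [exists_gammaBA_mulVec_eq_iff]
  have hρ := reducedB_density_nonneg A (graphState G)
  refine ⟨?_, fun hno => ?_, fun hno M i _ => ?_, ?_⟩
  · rintro ⟨x₀, hx₀⟩
    rw [tildeOp_reducedB_graphState_eq_self G A hx₀, fidelity_self hρ,
      trace_reducedB_graphState]
  · exact fidelity_eq_zero_of_mul_eq_zero hρ (reducedB_mul_tildeOp_graphState_eq_zero G A hno)
  · rw [tangle_postState, tangle_contractA_graphState_eq_zero G A hno, mul_zero]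
  · rintro ⟨x₀, hx₀⟩
    obtain ⟨M, hM⟩ := exists_measurement_adaptedVec G A
    refine ⟨M, fun i hi => ?_⟩
    have ht : tangle (contractA A (M i) (graphState G)) = outcomeProb M (graphState G) i := by
      rw [outcomeProb, hM]
      exact tangle_eq_norm_sq_of_tildeVec_eq_smul (by simp)
        (tildeVec_contractA_adaptedVec G A hB hx₀ i)
    rw [tangle_postState, ht, inv_mul_cancel₀ hi]
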